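/- Let $X$ be a Tychonoff space. A set $B\subseteq X$ is \emph{$u$-bounded}, for a cover $u$ of $X$, if $B\subseteq\bigcup c$ for some finite $c\subseteq u$. A \emph{multicover} of $X$ is a family $\lambda$ of covers of $X$. The pair $(X,\lambda)$ is \emph{Menger} (resp. \emph{Scheepers}, \emph{Hurewicz}) if for every sequence $(u_n)_{n\in\omega}$ in $\lambda$ there are $u_n$-bounded sets $B_n\subseteq X$ ($n\in\omega$) such that every $x\in X$ lies in some $B_n$ (resp. every finite $F\subseteq X$ is contained in some $B_n$; every $x\in X$ lies in $B_n$ for all but finitely many $n$). The pair $(X,\lambda)$ is \emph{winning} if player II has a winning strategy in the game in which, in inning $n\in\omega$, player I chooses $u_n\in\lambda$ and then player II chooses a $u_n$-bounded set $B_n\subseteq X$, and II wins if $\bigcup_{n}B_n=X$. The space $X$ is called Menger (resp. Scheepers, Hurewicz) if $(X,\mathcal O(X))$ is, where $\mathcal O(X)$ is the family of all open covers of $X$. The space $X$ is \emph{$C$-like} if player I has a winning strategy in the compact-open game, in which, in inning $n\in\omega$, player I chooses a compact set $K_n\subseteq X$ and then player II chooses an open set $U_n\supseteq K_n$, and I wins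 if $\bigcup_n U_n=X$. Let $\mathcal U(X)$ be the universal uniformity of $X$, i.e. the largest uniformity generating the topology of $X$, and let $\lambda_{\mathcal U(X)}=\{\{U(x):x\in X\}:U\in\mathcal U(X)\}$, where $U(x)=\{y\in X:(x,y)\in U\}$. Then $X$ is $C$-like (resp. Menger, Scheepers, Hurewicz) if and only if $X$ is Lindelöf and $(X,\lambda_{\mathcal U(X)})$ is winning (resp. Menger, Scheepers, Hurewicz). -/

import Mathlib

open Set Topology TopologicalSpace

namespace SelectionPrinciples

/-- A family `u` of subsets of `X` is a cover of `X`. -/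
def IsCover {X : Type*} (u : Set (Set X)) : Prop :=
  ⋃₀ u = univ

/-- A subset `B` of `X` is `u`-bounded if it is contained in the union of a finite
subfamily of `u`. -/
def IsBoundedBy {X : Type*} (u : Set (Set X)) (B : Set X) : Prop :=
  ∃ c : Set (Set X), c ⊆ u ∧ c.Finite ∧ B ⊆ ⋃₀ c

/-- A multicover of `X`: a family of covers of `X`. -/
structure Multicover (X : Type*) where
  /-- The covers belonging to the multicover. -/
  covers : Set (Set (Set X))
  /-- Every member is a cover. -/
  isCover : ∀ u ∈ covers, IsCover u

/-- The indexed family `B` is a cover of `X`. -/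
def IsSeqCover {X : Type*} (B : ℕ → Set X) : Prop :=
  ⋃ n, B n = univ

/-- The indexed family `B` is an `ω`-cover of `X`. -/
def IsOmegaCover {X : Type*} (B : ℕ → Set X) : Prop :=
  ∀ F : Set X, F.Finite → ∃ n, F ⊆ B n

/-- The indexed family `B` is a `γ`-cover of `X`. -/
def IsGammaCover {X : Type*} (B : ℕ → Set X) : Prop :=
  ∀ x : X, {n : ℕ | x ∉ B n}.Finite

namespace Multicover

/-- The Menger property of the multicovered space `(X, lam)`. -/
def IsMenger {X : Type*} (lam : Multicover X) : Prop :=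
  ∀ u : ℕ → Set (Set X), (∀ n, u n ∈ lam.covers) →
    ∃ B : ℕ → Set X, (∀ n, IsBoundedBy (u n) (B n)) ∧ IsSeqCover B

/-- The Scheepers property of the multicovered space `(X, lam)`. -/
def IsScheepers {X : Type*} (lam : Multicover X) : Prop :=
  ∀ u : ℕ → Set (Set X), (∀ n, u n ∈ lam.covers) →
    ∃ B : ℕ → Set X, (∀ n, IsBoundedBy (u n) (B n)) ∧ IsOmegaCover B

/-- The Hurewicz property of the multicovered space `(X, lam)`. -/
def IsHurewicz {X : Type*} (lam : Multicover X) : Prop :=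
  ∀ u : ℕ → Set (Set X), (∀ n, u n ∈ lam.covers) →
    ∃ B : ℕ → Set X, (∀ n, IsBoundedBy (u n) (B n)) ∧ IsGammaCover B

/-- In the game `CB` on `(X, lam)`, in inning `n` player I chooses a cover `u n` in `lam`, then
player II chooses a `u n`-bounded set `B n`; II wins if the sets `B n` cover `X`.
A strategy of II assigns to every nonempty finite sequence `(u 0, …, u n)` of covers from `lam`
a `u n`-bounded set. The multicovered space is winning if II has a winning strategy. -/
def IsWinning {X : Type*} (lam : Multicover X) : Prop :=
  ∃ Θ : (n : ℕ) → (Fin (n + 1) → lam.covers) → Set X,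
    (∀ (n : ℕ) (u : Fin (n + 1) → lam.covers),
      IsBoundedBy (u (Fin.last n) : Set (Set X)) (Θ n u)) ∧
    ∀ u : ℕ → lam.covers, ⋃ n : ℕ, Θ n (fun i => u i) = univ

/-- The multicover of all open covers of a topological space. -/
def openCovers (X : Type*) [TopologicalSpace X] : Multicover X where
  covers := {u | (∀ U ∈ u, IsOpen U) ∧ IsCover u}
  isCover := fun _ hu => hu.2

/-- The multicover of a uniform space `(X, 𝒰)`, consisting of the covers `{U(x) : x ∈ X}`
for `U ∈ 𝒰`, where `U(x) = {y : (x, y) ∈ U}`. -/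
def uniformCovers {X : Type*} (𝒰 : UniformSpace X) : Multicover X where
  covers := {u | ∃ U ∈ 𝒰.uniformity, u = range fun x : X => {y : X | (x, y) ∈ U}}
  isCover := by
    rintro _ ⟨U, hU, rfl⟩
    refine eq_univ_of_forall fun x => ⟨_, ⟨x, rfl⟩, ?_⟩
    exact @refl_mem_uniformity X 𝒰 x U hU

end Multicover

/-- `𝒰` is the universal uniformity of the space `X`: it generates the topology of `X` and
contains (as a family of entourages) every uniformity generating this topology. -/
def IsUniversalUniformity {X : Type*} [t : TopologicalSpace X] (𝒰 : UniformSpace X) : Prop :=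
  𝒰.toTopologicalSpace = t ∧
    ∀ 𝒱 : UniformSpace X, 𝒱.toTopologicalSpace = t →
      ∀ U ∈ 𝒱.uniformity, U ∈ 𝒰.uniformity

/-- The universal uniformity: the least upper bound (in the sense of entourages) of all
uniformities generating the topology. In Mathlib's order on `UniformSpace X`, finer uniformities
are smaller, so this is an infimum. -/
@[reducible]
def universalUniformity (X : Type*) [t : TopologicalSpace X] : UniformSpace X :=
  sInf {𝒱 : UniformSpace X | 𝒱.toTopologicalSpace = t}

/-- On a completely regular space, `universalUniformity X` is the universal uniformity. -/
theorem isUniversalUniformity_universalUniformity (X : Type*) [t : TopologicalSpace X]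
    [CompletelyRegularSpace X] : IsUniversalUniformity (universalUniformity X) := by
  refine ⟨?_, fun 𝒱 h𝒱 U hU => ?_⟩
  · obtain ⟨𝒱, h𝒱⟩ := CompletelyRegularSpace.exists_uniformSpace (X := X)
    rw [universalUniformity, UniformSpace.toTopologicalSpace_sInf]
    refine le_antisymm (iInf₂_le_of_le 𝒱 h𝒱 h𝒱.le) (le_iInf₂ fun 𝒲 h𝒲 => ?_)
    exact (Eq.symm h𝒲).le
  · have h : universalUniformity X ≤ 𝒱 := sInf_le h𝒱
    exact h hU

/-- The Menger property of a topological space. -/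
def MengerSpace (X : Type*) [TopologicalSpace X] : Prop :=
  (Multicover.openCovers X).IsMenger

/-- The Scheepers property of a topological space. -/
def ScheepersSpace (X : Type*) [TopologicalSpace X] : Prop :=
  (Multicover.openCovers X).IsScheepers

/-- The Hurewicz property of a topological space. -/
def HurewiczSpace (X : Type*) [TopologicalSpace X] : Prop :=
  (Multicover.openCovers X).IsHurewicz

/-- In the compact-open game on `X`, in inning `n` player I chooses a compact set `K n`, then
player II chooses an open set `U n ⊇ K n`; I wins if the sets `U n` cover `X`.
A strategy of I assigns a compact set to every finite sequence of open sets (the previous moves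
of II). The space is `C`-like if I has a winning strategy. -/
def CLike (X : Type*) [TopologicalSpace X] : Prop :=
  ∃ σ : (n : ℕ) → (Fin n → Opens X) → Compacts X,
    ∀ U : ℕ → Opens X,
      (∀ n : ℕ, (σ n (fun i => U i) : Set X) ⊆ (U n : Set X)) →
        ⋃ n : ℕ, (U n : Set X) = univ

end SelectionPrinciples

namespace SelectionPrinciples

/-! All four properties are inherited by a multicover each of whose covers is refined by a cover
from a multicover having the property. Open covers refine uniform covers (take interiors), and in a
Lindelöf Tychonoff space uniform covers refine open covers, by
`openCovers_isRefinedBy_uniformCovers`. Each property of the open covers implies Menger, hence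
Lindelöf.

It remains to match `C`-like with winning on open covers. From a strategy of I, II covers each
compact move by a bounded open set. Conversely, after a given position the closures of II's answers
to all open covers meet in a compact set, which I can play. Lindelöfness leaves countably many
covers to follow at each position, so I can visit a countable tree of positions; an uncovered point
would trace a branch on which II loses. -/

theorem exists_isOpen_closure_subset_of_mem {X : Type*} [TopologicalSpace X] [RegularSpace X]
    {U : Set X} (hU : IsOpen U) {x : X} (hx : x ∈ U) :
    ∃ V, IsOpen V ∧ x ∈ V ∧ closure V ⊆ U := by
  obtain ⟨V, ⟨hxV, hV⟩, hVU⟩ := (hasBasis_opens_closure x).mem_iff.1 (hU.mem_nhds hx)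
  exact ⟨V, hV, hxV, hVU⟩

namespace IsBoundedBy

variable {X : Type*} {u v : Set (Set X)} {B : Set X}

theorem of_refines (h : ∀ V ∈ v, ∃ U ∈ u, V ⊆ U) (hB : IsBoundedBy v B) : IsBoundedBy u B := by
  obtain ⟨c, hcv, hc, hBc⟩ := hB
  choose! f hfu hf using h
  refine ⟨f '' c, image_subset_iff.2 fun V hV => hfu V (hcv hV), hc.image f, fun x hx => ?_⟩
  obtain ⟨V, hV, hxV⟩ := hBc hx
  exact ⟨f V, mem_image_of_mem f hV, hf V (hcv hV) hxV⟩

end IsBoundedBy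

theorem IsOmegaCover.isSeqCover {X : Type*} {B : ℕ → Set X} (h : IsOmegaCover B) :
    IsSeqCover B :=
  eq_univ_of_forall fun x => by
    obtain ⟨n, hn⟩ := h {x} (finite_singleton x)
    exact mem_iUnion.2 ⟨n, hn rfl⟩

theorem IsGammaCover.isSeqCover {X : Type*} {B : ℕ → Set X} (h : IsGammaCover B) :
    IsSeqCover B :=
  eq_univ_of_forall fun x => by
    obtain ⟨n, hn⟩ := (h x).exists_notMem
    exact mem_iUnion.2 ⟨n, not_not.1 hn⟩

/-! ### Transfer along refinements; Menger implies Lindelöf. -/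

namespace Multicover

section Refines

variable {X : Type*} {lam mu : Multicover X}

/-- Every cover in `lam` is refined by some cover in `mu`. -/
def IsRefinedBy (lam mu : Multicover X) : Prop :=
  ∀ u ∈ lam.covers, ∃ v ∈ mu.covers, ∀ V ∈ v, ∃ U ∈ u, V ⊆ U

theorem IsMenger.of_isRefinedBy (hmu : mu.IsMenger) (h : lam.IsRefinedBy mu) :
    lam.IsMenger := by
  intro u hu
  choose v hv hvu using fun n => h (u n) (hu n)
  obtain ⟨B, hB, hcov⟩ := hmu v hv
  exact ⟨B, fun n => (hB n).of_refines (hvu n), hcov⟩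

theorem IsScheepers.of_isRefinedBy (hmu : mu.IsScheepers) (h : lam.IsRefinedBy mu) :
    lam.IsScheepers := by
  intro u hu
  choose v hv hvu using fun n => h (u n) (hu n)
  obtain ⟨B, hB, hcov⟩ := hmu v hv
  exact ⟨B, fun n => (hB n).of_refines (hvu n), hcov⟩

theorem IsHurewicz.of_isRefinedBy (hmu : mu.IsHurewicz) (h : lam.IsRefinedBy mu) :
    lam.IsHurewicz := by
  intro u hu
  choose v hv hvu using fun n => h (u n) (hu n)
  obtain ⟨B, hB, hcov⟩ := hmu v hv
  exact ⟨B, fun n => (hB n).of_refines (hvu n), hcov⟩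

theorem IsWinning.of_isRefinedBy (hmu : mu.IsWinning) (h : lam.IsRefinedBy mu) :
    lam.IsWinning := by
  choose! f hf hfu using h
  obtain ⟨Θ, hΘ, hwin⟩ := hmu
  let g : lam.covers → mu.covers := fun u => ⟨f u, hf u u.2⟩
  exact ⟨fun n u => Θ n (g ∘ u), fun n u => (hΘ n (g ∘ u)).of_refines (hfu _ (u _).2),
    fun u => hwin (g ∘ u)⟩

theorem IsScheepers.isMenger (h : lam.IsScheepers) : lam.IsMenger := fun u hu =>
  let ⟨B, hB, hcov⟩ := h u hu
  ⟨B, hB, hcov.isSeqCover⟩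

theorem IsHurewicz.isMenger (h : lam.IsHurewicz) : lam.IsMenger := fun u hu =>
  let ⟨B, hB, hcov⟩ := h u hu
  ⟨B, hB, hcov.isSeqCover⟩

theorem IsWinning.isMenger (h : lam.IsWinning) : lam.IsMenger := by
  obtain ⟨Θ, hΘ, hwin⟩ := h
  intro u hu
  let v : ℕ → lam.covers := fun n => ⟨u n, hu n⟩
  exact ⟨fun n => Θ n fun i => v i, fun n => hΘ n fun i => v i, hwin v⟩

end Refines

variable {X : Type*} [TopologicalSpace X]

theorem uniformCovers_isRefinedBy_openCovers [CompletelyRegularSpace X] :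
    (uniformCovers (universalUniformity X)).IsRefinedBy (openCovers X) := by
  rintro _ ⟨U, hU, rfl⟩
  have htop := (isUniversalUniformity_universalUniformity X).1
  have hnhds (x : X) : {y | (x, y) ∈ U} ∈ 𝓝 x := by
    have := @UniformSpace.ball_mem_nhds X (universalUniformity X) x U hU
    rw [htop] at this
    exact this
  refine ⟨range fun x => interior {y | (x, y) ∈ U}, ⟨?_, ?_⟩, ?_⟩
  · rintro _ ⟨x, rfl⟩
    exact isOpen_interior
  · exact eq_univ_of_forall fun x => ⟨_, ⟨x, rfl⟩, mem_interior_iff_mem_nhds.2 (hnhds x)⟩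
  · rintro _ ⟨x, rfl⟩
    exact ⟨_, ⟨x, rfl⟩, interior_subset⟩

/-- Playing the same cover in every inning yields countably many finite subfamilies that together
cover. -/
theorem IsMenger.lindelofSpace (h : (openCovers X).IsMenger) : LindelofSpace X := by
  refine ⟨isLindelof_of_countable_subcover fun {ι} U hUo hU => ?_⟩
  obtain ⟨B, hB, hcov⟩ := h (fun _ => range U)
    (fun _ => ⟨forall_mem_range.2 hUo, by
      rw [IsCover, sUnion_range]; exact univ_subset_iff.1 hU⟩)
  choose c hcU hc hBc using hB
  choose g hg using fun V : ⋃ n, c n => iUnion_subset hcU V.2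
  have : Countable (⋃ n, c n) := (countable_iUnion fun n => (hc n).countable).to_subtype
  refine ⟨range g, countable_range g, fun x _ => ?_⟩
  obtain ⟨n, hn⟩ := mem_iUnion.1 (hcov.ge (mem_univ x))
  obtain ⟨V, hV, hxV⟩ := hBc n hn
  refine mem_iUnion₂.2 ⟨_, mem_range_self ⟨V, mem_iUnion.2 ⟨n, hV⟩⟩, ?_⟩
  rwa [hg]

end Multicover

/-! ### Uniform refinements of open covers. -/

/-- In a regular Lindelöf space every open cover has a countable locally finite open
refinement. -/
theorem exists_locallyFinite_nat_refinement {X : Type*} [TopologicalSpace X] [RegularSpace X]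
    [LindelofSpace X] [Nonempty X] {u : Set (Set X)} (huo : ∀ U ∈ u, IsOpen U)
    (hu : ⋃₀ u = univ) :
    ∃ W : ℕ → Set X, (∀ n, IsOpen (W n)) ∧ ⋃ n, W n = univ ∧ LocallyFinite W ∧
      ∀ n, ∃ U ∈ u, W n ⊆ U := by
  have hx (x : X) : ∃ O ∈ u, ∃ V : Set X, x ∈ V ∧ IsOpen V ∧ closure V ⊆ O := by
    obtain ⟨O, hO, hxO⟩ := mem_sUnion.1 (hu ▸ mem_univ x)
    obtain ⟨V, hV, hxV, hVO⟩ :=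
      exists_isOpen_closure_subset_of_mem (huo O hO) hxO
    exact ⟨O, hO, V, hxV, hV, hVO⟩
  choose O hOu V hxV hVo hVO using hx
  obtain ⟨f, hf⟩ := isLindelof_univ.indexed_countable_subcover V hVo
    fun x _ => mem_iUnion.2 ⟨x, hxV x⟩
  -- Each `V (f m)` misses all sets with index beyond `m`, which gives local finiteness. The first
  -- `O (f n)` containing `x` keeps it, since `closure (V (f m)) ⊆ O (f m)`.
  refine ⟨fun n => O (f n) \ ⋃ m ∈ Iio n, closure (V (f m)), fun n => ?_, ?_, ?_, ?_⟩
  · exact (huo _ (hOu _)).sdiff ((finite_Iio n).isClosed_biUnion fun _ _ => isClosed_closure)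
  · classical
    refine eq_univ_of_forall fun x => mem_iUnion.2 ?_
    have hex : ∃ n, x ∈ O (f n) := by
      obtain ⟨n, hn⟩ := mem_iUnion.1 (hf (mem_univ x))
      exact ⟨n, hVO _ (subset_closure hn)⟩
    refine ⟨Nat.find hex, Nat.find_spec hex, fun hmem => ?_⟩
    obtain ⟨m, hm, hxm⟩ := mem_iUnion₂.1 hmem
    exact Nat.find_min hex hm (hVO _ hxm)
  · intro x
    obtain ⟨m, hm⟩ := mem_iUnion.1 (hf (mem_univ x))
    refine ⟨V (f m), (hVo _).mem_nhds hm, (finite_Iic m).subset ?_⟩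
    rintro n ⟨y, ⟨-, hy⟩, hyV⟩
    by_contra hn
    exact hy (mem_iUnion₂.2 ⟨m, not_le.1 (mt mem_Iic.2 hn), subset_closure hyV⟩)
  · exact fun n => ⟨_, hOu _, sdiff_subset⟩

/-- A locally finite family of continuous functions is continuous as a map into the space of
functions with the uniformity of uniform convergence. -/
theorem continuous_uniformFun_of_locallyFinite {X ι : Type*} [TopologicalSpace X]
    (f : ι → C(X, ℝ)) (hf : LocallyFinite fun i => Function.support (f i)) :
    Continuous fun x => UniformFun.ofFun fun i => f i x := by
  refine continuous_iff_continuousAt.2 fun x => ?_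
  rw [ContinuousAt, UniformFun.tendsto_iff_tendstoUniformly, Metric.tendstoUniformly_iff]
  intro ε hε
  obtain ⟨N, hN, hfin⟩ := hf x
  have hclose : ∀ᶠ y in 𝓝 x, ∀ i ∈ {i | (Function.support (f i) ∩ N).Nonempty},
      dist (f i x) (f i y) < ε :=
    (Filter.eventually_all_finite hfin).2 fun i _ => by
      have := Metric.tendsto_nhds.1 ((f i).continuous.tendsto x) ε hε
      simpa only [dist_comm] using this
  filter_upwards [hclose, hN] with y hy hyN i
  by_cases hi : (Function.support (f i) ∩ N).Nonempty
  · exact hy i hi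
  · have h0 : ∀ z ∈ N, f i z = 0 := fun z hz => by
      by_contra h
      exact hi ⟨z, h, hz⟩
    simpa [UniformFun.ofFun, UniformFun.toFun, h0 y hyN, h0 x (mem_of_mem_nhds hN)] using hε

/-- Adjoining the pullback of a uniformity along a continuous map does not change the topology, so
maximality applies. -/
theorem mem_universalUniformity_of_continuous {X Y : Type*} [TopologicalSpace X]
    [CompletelyRegularSpace X] [𝒲 : UniformSpace Y] {g : X → Y} (hg : Continuous g)
    {U : Set (Y × Y)} (hU : U ∈ uniformity Y) :
    {p : X × X | (g p.1, g p.2) ∈ U} ∈ (universalUniformity X).uniformity := by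
  obtain ⟨htop, hmax⟩ := isUniversalUniformity_universalUniformity X
  refine hmax (universalUniformity X ⊓ 𝒲.comap g) ?_ _ ?_
  · rw [UniformSpace.toTopologicalSpace_inf, htop]
    exact inf_eq_left.2 hg.le_induced
  · have h : universalUniformity X ⊓ 𝒲.comap g ≤ 𝒲.comap g := inf_le_right
    exact h (Filter.preimage_mem_comap hU)

theorem Multicover.openCovers_isRefinedBy_uniformCovers {X : Type*} [TopologicalSpace X]
    [T35Space X] [LindelofSpace X] :
    (openCovers X).IsRefinedBy (uniformCovers (universalUniformity X)) := by
  rintro u ⟨huo, hu⟩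
  cases isEmpty_or_nonempty X
  · exact ⟨_, ⟨univ, Filter.univ_mem, rfl⟩, forall_mem_range.2 isEmptyElim⟩
  obtain ⟨W, hWo, hW, hWfin, hWu⟩ := exists_locallyFinite_nat_refinement huo hu
  obtain ⟨f, hf⟩ := BumpCovering.exists_isSubordinate_of_locallyFinite isClosed_univ W hWo hWfin
    hW.ge
  have hU : {p : (UniformFun ℕ ℝ) × (UniformFun ℕ ℝ) |
      ∀ n, (UniformFun.toFun p.1 n, UniformFun.toFun p.2 n) ∈ {q : ℝ × ℝ | dist q.1 q.2 < 1}} ∈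
      uniformity (UniformFun ℕ ℝ) :=
    (UniformFun.hasBasis_uniformity ℕ ℝ).mem_of_mem (Metric.dist_mem_uniformity one_pos)
  refine ⟨_, ⟨_, mem_universalUniformity_of_continuous
    (continuous_uniformFun_of_locallyFinite (fun n => f n) f.locallyFinite) hU, rfl⟩, ?_⟩
  refine forall_mem_range.2 fun x => ?_
  -- The function with index `f.ind x` equals 1 at `x`. Any `y` at uniform distance below 1 has a
  -- nonzero value there, so it lies in the same `W`.
  obtain ⟨O, hO, hWO⟩ := hWu (f.ind x (mem_univ x))
  refine ⟨O, hO, fun y hy => hWO (hf _ (subset_tsupport _ fun h0 => ?_))⟩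
  have := hy (f.ind x (mem_univ x))
  simp [UniformFun.toFun, UniformFun.ofFun, f.ind_apply, h0] at this

/-! ### The compact-open game and the cover game. -/

section Games

variable {X : Type*} [TopologicalSpace X]

open Multicover

theorem exists_bounded_open_superset (u : (openCovers X).covers) (K : Compacts X) :
    ∃ U : Opens X, (K : Set X) ⊆ U ∧ IsBoundedBy (u : Set (Set X)) U := by
  obtain ⟨c, hcu, hc, hKc⟩ := K.isCompact.elim_finite_subcover_image (b := (u : Set (Set X)))
    (c := id) u.2.1 (by
      have h : ⋃₀ (u : Set (Set X)) = univ := u.2.2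
      rw [sUnion_eq_biUnion] at h
      exact (subset_univ _).trans h.ge)
  refine ⟨⟨⋃₀ c, isOpen_sUnion fun U hU => u.2.1 U (hcu hU)⟩, ?_, c, hcu, hc, subset_rfl⟩
  simpa [sUnion_eq_biUnion] using hKc

/-- The moves of II in the compact-open game played against the strategy `σ` of I, when II
answers a compact set `K` in inning `n` by `r (u n) K`. -/
def compactOpenPlay {ι : Type*} (σ : (n : ℕ) → (Fin n → Opens X) → Compacts X)
    (r : ι → Compacts X → Opens X) (u : ℕ → ι) (n : ℕ) : Opens X :=
  r (u n) (σ n fun i => compactOpenPlay σ r u i)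
termination_by n
decreasing_by exact i.2

theorem compactOpenPlay_congr {ι : Type*} (σ : (n : ℕ) → (Fin n → Opens X) → Compacts X)
    (r : ι → Compacts X → Opens X) {u v : ℕ → ι} {n : ℕ} (h : ∀ i ≤ n, u i = v i) :
    compactOpenPlay σ r u n = compactOpenPlay σ r v n := by
  induction n using Nat.strong_induction_on with
  | _ n ih =>
    rw [compactOpenPlay, compactOpenPlay, h n le_rfl]
    congr 2
    funext i
    exact ih i i.2 fun j hj => h j (hj.trans i.2.le)

theorem CLike.isWinning_openCovers (h : CLike X) : (openCovers X).IsWinning := by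
  obtain ⟨σ, hσ⟩ := h
  choose r hKr hr using exists_bounded_open_superset (X := X)
  -- Indices beyond `n` wrap around; the play up to inning `n` never reads them.
  let ext (n : ℕ) (u : Fin (n + 1) → (openCovers X).covers) (k : ℕ) : (openCovers X).covers :=
    u (Fin.ofNat (n + 1) k)
  refine ⟨fun n u => compactOpenPlay σ r (ext n u) n, fun n u => ?_, fun u => ?_⟩
  · have h : ext n u n = u (Fin.last n) := congrArg u (Fin.ext (by simp))
    simp only
    rw [compactOpenPlay, h]
    exact hr _ _
  · have h (n : ℕ) : compactOpenPlay σ r (ext n fun i => u i) n = compactOpenPlay σ r u n :=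
      compactOpenPlay_congr σ r fun i hi =>
        congrArg u (by simp [Nat.mod_eq_of_lt (Nat.lt_succ_of_le hi)])
    simp only [h]
    refine hσ _ fun n => ?_
    rw [compactOpenPlay]
    exact hKr _ _

/-- If a function chooses for every open cover of a regular space a set bounded by it, then the
intersection of the closures of all these sets is compact. -/
theorem isCompact_iInter_closure_of_isBoundedBy [RegularSpace X]
    {B : (openCovers X).covers → Set X}
    (hB : ∀ u : (openCovers X).covers, IsBoundedBy (u : Set (Set X)) (B u)) :
    IsCompact (⋂ u : (openCovers X).covers, closure (B u)) := by
  classical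
  refine isCompact_of_finite_subcover ?_
  intro ι U hUo hU
  set K := ⋂ u : (openCovers X).covers, closure (B u)
  have hKc : IsClosed K := isClosed_iInter fun _ => isClosed_closure
  -- `K ⊆ closure (B v)` lies in the closures of finitely many members of `v`, and each of these
  -- meets `K` in a finitely covered set.
  let v : Set (Set X) := {W | IsOpen W ∧ ∃ t : Finset ι, closure W ∩ K ⊆ ⋃ i ∈ t, U i}
  have hv : v ∈ (openCovers X).covers := by
    refine ⟨fun W hW => hW.1, eq_univ_of_forall fun x => ?_⟩
    by_cases hx : x ∈ K
    · obtain ⟨i, hi⟩ := mem_iUnion.1 (hU hx)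
      obtain ⟨W, hW, hxW, hWU⟩ := exists_isOpen_closure_subset_of_mem (hUo i) hi
      exact ⟨W, ⟨hW, {i}, by simpa using inter_subset_left.trans hWU⟩, hxW⟩
    · obtain ⟨W, hW, hxW, hWU⟩ := exists_isOpen_closure_subset_of_mem hKc.isOpen_compl hx
      exact ⟨W, ⟨hW, ∅, fun y hy => (hWU hy.1 hy.2).elim⟩, hxW⟩
  obtain ⟨c, hcv, hc, hBc⟩ := hB ⟨v, hv⟩
  have hct : ∀ W ∈ c, ∃ t : Finset ι, closure W ∩ K ⊆ ⋃ i ∈ t, U i := fun W hW => (hcv hW).2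
  choose! t ht using hct
  refine ⟨hc.toFinset.biUnion t, fun x hx => ?_⟩
  have hx' : x ∈ ⋃ W ∈ c, closure W := by
    rw [← hc.closure_biUnion, ← sUnion_eq_biUnion]
    exact closure_mono hBc (mem_iInter.1 hx ⟨v, hv⟩)
  obtain ⟨W, hW, hxW⟩ := mem_iUnion₂.1 hx'
  obtain ⟨i, hi, hxi⟩ := mem_iUnion₂.1 (ht W hW ⟨hxW, hx⟩)
  exact mem_iUnion₂.2 ⟨i, Finset.mem_biUnion.2 ⟨W, hc.mem_toFinset.2 hW, hi⟩, hxi⟩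

/-- The finite sequences attached to the nodes of the tree on `ℕ` in which the node `n + 1` is the
successor number `(Nat.unpair n).2` of the node `(Nat.unpair n).1`; the successor number `k` of the
node `p` extends the sequence `s` at `p` by `e s (U p) k`. -/
def treeSeq {α β : Type*} (e : List α → β → ℕ → α) (U : ℕ → β) : ℕ → List α
  | 0 => []
  | n + 1 =>
    have : n.unpair.1 < n + 1 := Nat.lt_succ_of_le n.unpair_left_le
    treeSeq e U n.unpair.1 ++ [e (treeSeq e U n.unpair.1) (U n.unpair.1) n.unpair.2]

theorem treeSeq_congr {α β : Type*} (e : List α → β → ℕ → α) {U V : ℕ → β} {n : ℕ}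
    (h : ∀ i < n, U i = V i) : treeSeq e U n = treeSeq e V n := by
  induction n using Nat.strong_induction_on with
  | _ n ih =>
    cases n with
    | zero => simp only [treeSeq]
    | succ n =>
      have hlt : n.unpair.1 < n + 1 := Nat.lt_succ_of_le n.unpair_left_le
      rw [treeSeq, treeSeq, ih _ hlt fun i hi => h i (hi.trans hlt), h _ hlt]

theorem treeSeq_succ_pair {α β : Type*} (e : List α → β → ℕ → α) (U : ℕ → β) (p k : ℕ) :
    treeSeq e U (Nat.pair p k + 1) = treeSeq e U p ++ [e (treeSeq e U p) (U p) k] := by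
  rw [treeSeq, Nat.unpair_pair]

theorem Multicover.IsWinning.cLike [RegularSpace X] [LindelofSpace X]
    (h : (openCovers X).IsWinning) : CLike X := by
  obtain ⟨Θ, hΘ, hwin⟩ := h
  let cov := (openCovers X).covers
  have : Nonempty cov :=
    ⟨⟨{univ}, fun U hU => by rw [mem_singleton_iff.1 hU]; exact isOpen_univ, sUnion_singleton _⟩⟩
  -- II's answer to `u` after the covers in `s`; all indices are in range, so the default is never
  -- used.
  let B (s : List cov) (u : cov) : Set X := Θ s.length fun i => (s ++ [u]).getD i u
  have hB (s : List cov) (u : cov) : IsBoundedBy (u : Set (Set X)) (B s u) := by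
    have h := hΘ s.length fun i => (s ++ [u]).getD i u
    have hlast : (s ++ [u]).getD (Fin.last s.length : ℕ) u = u := by simp
    beta_reduce at h
    rwa [hlast] at h
  let K (s : List cov) : Compacts X :=
    ⟨⋂ u, closure (B s u), isCompact_iInter_closure_of_isBoundedBy (hB s)⟩
  -- The inclusion is a premise inside the existential so that `e` is total, as `treeSeq` requires.
  have hex (s : List cov) (U : Opens X) :
      ∃ e : ℕ → cov, (K s : Set X) ⊆ U → ∀ x ∉ U, ∃ k, x ∉ B s (e k) := by
    by_cases hKU : (K s : Set X) ⊆ U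
    · obtain ⟨e, he⟩ := (U.isOpen.isClosed_compl.isLindelof).indexed_countable_subcover
        (fun u => (closure (B s u))ᶜ) (fun u => isClosed_closure.isOpen_compl) (by
          rw [← compl_iInter]
          exact compl_subset_compl.2 hKU)
      refine ⟨e, fun _ x hx => ?_⟩
      obtain ⟨k, hk⟩ := mem_iUnion.1 (he hx)
      exact ⟨k, fun hxk => hk (subset_closure hxk)⟩
    · exact ⟨fun _ => Classical.arbitrary cov, fun h => (hKU h).elim⟩
  choose e he using hex
  -- The filler `⊥` is harmless: `treeSeq` at node `n` reads only moves before `n`.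
  let ext (n : ℕ) (U : Fin n → Opens X) (k : ℕ) : Opens X := if hk : k < n then U ⟨k, hk⟩ else ⊥
  refine ⟨fun n U => K (treeSeq e (ext n U) n), fun U hU => eq_univ_of_forall fun x => ?_⟩
  have hext (n : ℕ) : treeSeq e (ext n fun i => U i) n = treeSeq e U n :=
    treeSeq_congr e fun i hi => dif_pos hi
  simp only [hext] at hU
  by_contra hx
  have hxU (n : ℕ) : x ∉ U n := fun hn => hx (mem_iUnion.2 ⟨n, hn⟩)
  choose k hk using fun n => he _ _ (hU n) x (hxU n)
  -- The branch followed by the uncovered `x`: at each node it takes a successor cover to which II's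
  -- answer misses `x`. The covers `u` along it form a play that II's strategy should win.
  let b : ℕ → ℕ := fun j => Nat.rec 0 (fun _ p => Nat.pair p (k p) + 1) j
  let u (j : ℕ) : cov := e (treeSeq e U (b j)) (U (b j)) (k (b j))
  have hb (j : ℕ) : treeSeq e U (b j) = (List.range j).map u := by
    induction j with
    | zero => exact treeSeq.eq_1 e U
    | succ j ih =>
      rw [List.range_succ, List.map_append, ← ih]
      exact treeSeq_succ_pair e U (b j) (k (b j))
  obtain ⟨j, hj⟩ := mem_iUnion.1 ((hwin u).ge (mem_univ x))
  refine hk (b j) ?_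
  have hBeq (s : List cov) (v : cov) (n : ℕ) (hn : s.length = n) :
      B s v = Θ n fun i => (s ++ [v]).getD i v := by
    subst hn
    rfl
  change x ∈ B (treeSeq e U (b j)) (u j)
  rw [hb, hBeq _ _ j (by simp)]
  convert hj using 2
  funext i
  rw [← List.map_singleton (f := u), ← List.map_append, ← List.range_succ]
  simp [List.getD, List.getElem?_range i.2]

end Games

end SelectionPrinciples

theorem mainTheorem6 (X : Type*) [TopologicalSpace X] [T35Space X] :
    (SelectionPrinciples.CLike X ↔
      LindelofSpace X ∧
        (SelectionPrinciples.Multicover.uniformCovers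
          (SelectionPrinciples.universalUniformity X)).IsWinning) ∧
    (SelectionPrinciples.MengerSpace X ↔
      LindelofSpace X ∧
        (SelectionPrinciples.Multicover.uniformCovers
          (SelectionPrinciples.universalUniformity X)).IsMenger) ∧
    (SelectionPrinciples.ScheepersSpace X ↔
      LindelofSpace X ∧
        (SelectionPrinciples.Multicover.uniformCovers
          (SelectionPrinciples.universalUniformity X)).IsScheepers) ∧
    (SelectionPrinciples.HurewiczSpace X ↔
      LindelofSpace X ∧
        (SelectionPrinciples.Multicover.uniformCovers
          (SelectionPrinciples.universalUniformity X)).IsHurewicz) := by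
  open SelectionPrinciples Multicover in
  have hUO := uniformCovers_isRefinedBy_openCovers (X := X)
  have hOU (_ : LindelofSpace X) := openCovers_isRefinedBy_uniformCovers (X := X)
  refine ⟨⟨fun h => ?_, fun ⟨hL, h⟩ => (h.of_isRefinedBy (hOU hL)).cLike⟩,
    ⟨fun h => ?_, fun ⟨hL, h⟩ => h.of_isRefinedBy (hOU hL)⟩,
    ⟨fun h => ?_, fun ⟨hL, h⟩ => h.of_isRefinedBy (hOU hL)⟩,
    ⟨fun h => ?_, fun ⟨hL, h⟩ => h.of_isRefinedBy (hOU hL)⟩⟩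
  · have hw := h.isWinning_openCovers
    exact ⟨hw.isMenger.lindelofSpace, hw.of_isRefinedBy hUO⟩
  · exact ⟨Multicover.IsMenger.lindelofSpace h, Multicover.IsMenger.of_isRefinedBy h hUO⟩
  · exact ⟨(Multicover.IsScheepers.isMenger h).lindelofSpace,
      Multicover.IsScheepers.of_isRefinedBy h hUO⟩
  · exact ⟨(Multicover.IsHurewicz.isMenger h).lindelofSpace,
      Multicover.IsHurewicz.of_isRefinedBy h hUO⟩
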